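/- Let $G$ be a locally compact Hausdorff topological group with a fixed (regular) left Haar measure $\mu$, and let $L^1(G)$ be the complex Banach algebra of (classes of) $\mu$-integrable functions $G\to\mathbb{C}$ with the convolution product $(f*g)(x)=\int_G f(y)\,g(y^{-1}x)\,d\mu(y)$. An epimorphism on $L^1(G)$ is a surjective linear map $T:L^1(G)\to L^1(G)$ with $T(f*g)=T(f)*T(g)$ for all $f,g\in L^1(G)$; it is weakly compact if it maps every norm-bounded subset of $L^1(G)$ to a relatively weakly compact subset of $L^1(G)$. Then there exists a weakly compact epimorphism on $L^1(G)$ if and only if $G$ is finite. -/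

import Mathlib

open MeasureTheory Filter Topology
open scoped ENNReal

/-- A linear operator between complex normed spaces is *weakly compact* if it maps bounded sets to
relatively weakly compact sets, i.e. sets whose closure in the weak topology `σ(F, F*)` is
compact for that topology. (Such an operator is automatically continuous.) -/
def IsWeaklyCompactOperator {E F : Type*} [NormedAddCommGroup E] [NormedSpace ℂ E]
    [NormedAddCommGroup F] [NormedSpace ℂ F] (T : E →ₗ[ℂ] F) : Prop :=
  ∀ S : Set E, Bornology.IsBounded S →
    IsCompact (closure ((fun x : E => toWeakSpace ℂ F (T x)) '' S))

namespace GroupAlgebraL1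

variable {G : Type*} [Group G] [TopologicalSpace G] [IsTopologicalGroup G]
  [MeasurableSpace G] [BorelSpace G] {μ : Measure G} [μ.IsHaarMeasure]

/-- Left translation on `L¹(G)`: `(translate y g) x = g (y⁻¹ x)`. -/
noncomputable def translate (y : G) (g : Lp ℂ 1 μ) : Lp ℂ 1 μ :=
  Lp.compMeasurePreserving (fun x : G => y⁻¹ * x) (measurePreserving_mul_left μ y⁻¹) g

/-- The convolution product of `L¹(G)`, `(f ∗ g)(x) = ∫ f(y) g(y⁻¹ x) dμ(y)`, written as the
`L¹(G)`-valued Bochner integral `∫ f(y) • g(y⁻¹ ·) dμ(y)`. The integrand is always integrable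
(`integrable_smul_translate`), and this is the convolution product of the measures `f dμ` and
`g dμ` (`integral_mul_conv`). -/
noncomputable def conv (f g : Lp ℂ 1 μ) : Lp ℂ 1 μ :=
  ∫ y, f y • translate y g ∂μ

/-- `T` is an epimorphism of the convolution algebra `L¹(G)`: a surjective algebra homomorphism
from `L¹(G)` to itself. -/
def IsEpimorphism (T : Lp ℂ 1 μ →ₗ[ℂ] Lp ℂ 1 μ) : Prop :=
  (∀ f g : Lp ℂ 1 μ, T (conv f g) = conv (T f) (T g)) ∧ Function.Surjective T

theorem norm_translate (y : G) (g : Lp ℂ 1 μ) : ‖translate y g‖ = ‖g‖ :=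
  Lp.norm_compMeasurePreserving g _

theorem coeFn_translate (y : G) (g : Lp ℂ 1 μ) :
    translate y g =ᵐ[μ] fun x => g (y⁻¹ * x) :=
  Lp.coeFn_compMeasurePreserving g (measurePreserving_mul_left μ y⁻¹)

theorem continuous_translate [LocallyCompactSpace G] [μ.Regular] (g : Lp ℂ 1 μ) :
    Continuous fun y : G => translate y g := by
  let F : C(G, C(G, G)) :=
    (ContinuousMap.mk (fun a : G × G => a.1⁻¹ * a.2) (by fun_prop)).curry
  exact (continuous_const (y := g)).compMeasurePreservingLp F.continuous
    (fun y => measurePreserving_mul_left μ y⁻¹) ENNReal.one_ne_top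

theorem aestronglyMeasurable_restrict [LocallyCompactSpace G] [μ.Regular]
    {E : Type*} [NormedAddCommGroup E] {h : G → E} (hh : Continuous h) {s : Set G}
    (hs : MeasurableSet s) (hμs : μ s ≠ ∞) : AEStronglyMeasurable h (μ.restrict s) := by
  have hpos : ∀ n : ℕ, ((n : ℝ≥0∞) + 1)⁻¹ ≠ 0 := fun n => by simp
  choose K hKs hK hKc hKμ using fun n : ℕ => hs.exists_isCompact_isClosed_sdiff_lt hμs (hpos n)
  have hu : AEStronglyMeasurable h (μ.restrict (⋃ n, K n)) :=
    AEStronglyMeasurable.iUnion fun n =>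
      hh.continuousOn.aestronglyMeasurable_of_isCompact (hK n) (hKc n).measurableSet
  have hnull : μ (s \ ⋃ n, K n) = 0 := by
    have h0 : Tendsto (fun n : ℕ => ((n : ℝ≥0∞) + 1)⁻¹) atTop (𝓝 0) := by
      have := ENNReal.tendsto_inv_nat_nhds_zero.comp (tendsto_add_atTop_nat 1)
      refine this.congr fun n => ?_
      simp
    refine le_antisymm (ge_of_tendsto' h0 fun n => ?_) zero_le
    exact (measure_mono (Set.sdiff_subset_sdiff_right (Set.subset_iUnion K n))).trans (hKμ n).le
  have hle : (⋃ n, K n) ⊆ s := Set.iUnion_subset hKs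
  have : (⋃ n, K n) =ᵐ[μ] s :=
    (LE.le.eventuallyLE hle).antisymm (ae_le_set.2 hnull)
  rwa [← Measure.restrict_congr_set this]

/-- The integrand in the definition of the convolution is Bochner integrable. -/
theorem integrable_smul_translate [LocallyCompactSpace G] [μ.Regular] (f g : Lp ℂ 1 μ) :
    Integrable (fun y => f y • translate y g) μ := by
  have hf : Integrable f μ := L1.integrable_coeFn f
  have hm : AEStronglyMeasurable (fun y => f y • translate y g) μ := by
    refine Integrable.induction
      (fun f : G → ℂ => AEStronglyMeasurable (fun y => f y • translate y g) μ)
      ?_ ?_ ?_ ?_ hf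
    · intro c s hs hμs
      have h1 : (fun y => s.indicator (fun _ => c) y • translate y g)
          = s.indicator fun y => c • translate y g := by
        ext1 y
        by_cases hy : y ∈ s <;> simp [hy]
      rw [h1, aestronglyMeasurable_indicator_iff hs]
      exact aestronglyMeasurable_restrict ((continuous_translate g).const_smul c) hs hμs.ne
    · intro u v _ _ _ hu hv
      simp only [Pi.add_apply, add_smul]
      exact hu.add hv
    · refine IsSeqClosed.isClosed fun u v hu hv => ?_
      obtain ⟨ns, -, hns⟩ := (tendstoInMeasure_of_tendsto_Lp hv).exists_seq_tendsto_ae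
      refine aestronglyMeasurable_of_tendsto_ae atTop
        (f := fun n y => u (ns n) y • translate y g) (fun n => hu (ns n)) ?_
      filter_upwards [hns] with y hy
      exact hy.smul_const _
    · intro u v huv _ hu
      refine hu.congr ?_
      filter_upwards [huv] with y hy
      rw [hy]
  refine (hf.norm.mul_const ‖g‖).mono hm (Eventually.of_forall fun y => ?_)
  simp [norm_smul, norm_translate]

/-- As a measure, `conv f g` is the convolution of the measures `f dμ` and `g dμ`: for every
bounded continuous `φ` (in particular for `φ` in `C₀(G)`), the integral of `φ` against it is
`∫ f(x) ∫ g(y) φ(xy) dy dx`. -/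
theorem integral_mul_conv [LocallyCompactSpace G] [μ.Regular] (f g : Lp ℂ 1 μ)
    (φ : BoundedContinuousFunction G ℂ) :
    ∫ z, φ z * conv f g z ∂μ = ∫ x, f x * ∫ y, g y * φ (x * y) ∂μ ∂μ := by
  have hint : ∀ h : Lp ℂ 1 μ, Integrable (fun z => φ z * h z) μ := fun h =>
    (L1.integrable_coeFn h).bdd_mul (c := ‖φ‖) φ.continuous.aestronglyMeasurable
      (Eventually.of_forall φ.norm_coe_le_norm)
  let L₀ : Lp ℂ 1 μ →ₗ[ℂ] ℂ :=
    { toFun := fun h => ∫ z, φ z * h z ∂μ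
      map_add' := fun h k => by
        rw [← integral_add (hint h) (hint k)]
        refine integral_congr_ae ?_
        filter_upwards [Lp.coeFn_add h k] with z hz
        rw [hz, Pi.add_apply, mul_add]
      map_smul' := fun c h => by
        rw [RingHom.id_apply, smul_eq_mul, ← integral_const_mul]
        refine integral_congr_ae ?_
        filter_upwards [Lp.coeFn_smul c h] with z hz
        rw [hz, Pi.smul_apply, smul_eq_mul, mul_left_comm] }
  let L : Lp ℂ 1 μ →L[ℂ] ℂ := L₀.mkContinuous ‖φ‖ fun h => by
    refine (norm_integral_le_integral_norm _).trans ?_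
    rw [L1.norm_eq_integral_norm, ← integral_const_mul]
    refine integral_mono (hint h).norm ((L1.integrable_coeFn h).norm.const_mul _) fun z => ?_
    simp only [norm_mul]
    exact mul_le_mul_of_nonneg_right (φ.norm_coe_le_norm z) (norm_nonneg _)
  have h1 : L (conv f g) = ∫ x, L (f x • translate x g) ∂μ :=
    (L.integral_comp_comm (integrable_smul_translate f g)).symm
  refine h1.trans (integral_congr_ae (Eventually.of_forall fun x => ?_))
  simp only [map_smul, smul_eq_mul]
  congr 1
  change ∫ z, φ z * translate x g z ∂μ = _
  rw [← integral_mul_left_eq_self (fun z => φ z * translate x g z) x]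
  refine integral_congr_ae ?_
  filter_upwards [(measurePreserving_mul_left μ x).quasiMeasurePreserving.ae
    (coeFn_translate x g)] with y hy
  rw [hy, inv_mul_cancel_left, mul_comm]

end GroupAlgebraL1

section WeakCompactness

variable {E F : Type*} [NormedAddCommGroup E] [NormedSpace ℂ E]
  [NormedAddCommGroup F] [NormedSpace ℂ F]

theorem continuous_eval_toWeakSpace_symm (φ : F →L[ℂ] ℂ) :
    Continuous fun w : WeakSpace ℂ F => φ ((toWeakSpace ℂ F).symm w) :=
  WeakBilin.eval_continuous (topDualPairing ℂ F).flip φ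

/-- Limits along an ultrafilter come straight from compactness, with no need of Eberlein–Šmulian to
extract a subsequence. -/
theorem IsCompact.exists_hyperfilter_tendsto_of_toWeakSpace {K : Set (WeakSpace ℂ F)}
    (hK : IsCompact K) {u : ℕ → F} (hu : ∀ n, toWeakSpace ℂ F (u n) ∈ K) :
    ∃ y : F, ∀ φ : F →L[ℂ] ℂ, Tendsto (fun n => φ (u n)) (hyperfilter ℕ) (𝓝 (φ y)) := by
  obtain ⟨w, -, hw⟩ := hK.ultrafilter_le_nhds ((hyperfilter ℕ).map fun n => toWeakSpace ℂ F (u n))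
    (le_principal_iff.2 (univ_mem' (f := hyperfilter ℕ) hu))
  exact ⟨(toWeakSpace ℂ F).symm w, fun φ =>
    ((continuous_eval_toWeakSpace_symm φ).tendsto w).comp (f := fun n => toWeakSpace ℂ F (u n)) hw⟩

/-- Some closed ball of the target of a surjective weakly compact operator is contained in a weakly
compact set. -/
theorem IsWeaklyCompactOperator.exists_closedBall_subset [CompleteSpace F] {T : E →ₗ[ℂ] F}
    (hT : IsWeaklyCompactOperator T) (hs : Function.Surjective T) :
    ∃ K : Set (WeakSpace ℂ F), IsCompact K ∧ ∃ x : F, ∃ r > 0, ∀ z ∈ Metric.closedBall x r,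
      toWeakSpace ℂ F z ∈ K := by
  -- Baire: by surjectivity, the norm closures of the images of the balls of radius `n` cover `F`.
  obtain ⟨n, x, hx⟩ := nonempty_interior_of_iUnion_of_closed
    (f := fun n : ℕ => closure (T '' Metric.closedBall 0 n)) (fun _ => isClosed_closure) <| by
      refine Set.eq_univ_of_forall fun y => ?_
      obtain ⟨e, rfl⟩ := hs y
      obtain ⟨n, hn⟩ := exists_nat_ge ‖e‖
      exact Set.mem_iUnion.2 ⟨n, subset_closure ⟨e, by simpa using hn, rfl⟩⟩
  obtain ⟨r, hr, hball⟩ := Metric.nhds_basis_closedBall.mem_iff.1 (mem_interior_iff_mem_nhds.1 hx)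
  refine ⟨_, hT _ (Metric.isBounded_closedBall (x := (0 : E)) (r := n)), x, r, hr, fun z hz => ?_⟩
  -- The norm closure lies in the weak closure, so neither continuity nor openness of `T` is needed.
  have h := image_closure_subset_closure_image (toWeakSpaceCLM ℂ F).continuous
    (Set.mem_image_of_mem _ (hball hz))
  rwa [Set.image_image] at h

theorem IsWeaklyCompactOperator.exists_hyperfilter_tendsto [CompleteSpace F] {T : E →ₗ[ℂ] F}
    (hT : IsWeaklyCompactOperator T) (hs : Function.Surjective T) {u : ℕ → F}
    (hu : ∀ n, ‖u n‖ ≤ 1) :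
    ∃ y : F, ∀ φ : F →L[ℂ] ℂ, Tendsto (fun n => φ (u n)) (hyperfilter ℕ) (𝓝 (φ y)) := by
  obtain ⟨K, hK, x, r, hr, hball⟩ := hT.exists_closedBall_subset hs
  -- The affine map `v ↦ x + r • v` carries the unit ball into `K`; its inverse is applied to the
  -- limit.
  obtain ⟨y, hy⟩ := hK.exists_hyperfilter_tendsto_of_toWeakSpace
    (u := fun n => x + (r : ℂ) • u n) fun n => hball _ <| by
      rw [mem_closedBall_iff_norm, add_sub_cancel_left, norm_smul, Complex.norm_real,
        Real.norm_of_nonneg hr.le]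
      exact mul_le_of_le_one_right hr.le (hu n)
  refine ⟨(r : ℂ)⁻¹ • (y - x), fun φ => ?_⟩
  have hr' : (r : ℂ) ≠ 0 := by exact_mod_cast hr.ne'
  have h := ((hy φ).sub_const (φ x)).const_mul (r : ℂ)⁻¹
  simpa [hr'] using h

theorem isWeaklyCompactOperator_of_finiteDimensional [FiniteDimensional ℂ E] (T : E →ₗ[ℂ] F) :
    IsWeaklyCompactOperator T := by
  intro S hS
  have : ProperSpace E := FiniteDimensional.proper ℂ E
  have hc : Continuous fun x : E => toWeakSpace ℂ F (T x) :=
    (toWeakSpaceCLM ℂ F).continuous.comp T.continuous_of_finiteDimensional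
  exact (hS.isCompact_closure.image hc).closure_of_subset (Set.image_mono subset_closure)

end WeakCompactness

section DisjointSets

variable {X : Type*} [MeasurableSpace X] {μ : Measure X}

/-- Integration over a set, as a continuous linear functional on `L¹`. -/
noncomputable def setIntegralLpCLM (μ : Measure X) (s : Set X) : Lp ℂ 1 μ →L[ℂ] ℂ where
  toFun f := ∫ x in s, f x ∂μ
  map_add' f g := by
    rw [← integral_add (L1.integrable_coeFn f).integrableOn (L1.integrable_coeFn g).integrableOn]
    exact integral_congr_ae (ae_restrict_of_ae (Lp.coeFn_add f g))
  map_smul' c f := by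
    rw [RingHom.id_apply, ← integral_smul]
    exact integral_congr_ae (ae_restrict_of_ae (Lp.coeFn_smul c f))
  cont := continuous_setIntegral s

theorem setIntegralLpCLM_apply (s : Set X) (f : Lp ℂ 1 μ) :
    setIntegralLpCLM μ s f = ∫ x in s, f x ∂μ := rfl

theorem setIntegralLpCLM_indicatorConstLp {s t : Set X} (hs : MeasurableSet s)
    (ht : MeasurableSet t) (hμt : μ t ≠ ∞) (c : ℂ) :
    setIntegralLpCLM μ s (indicatorConstLp 1 ht hμt c) = (μ.real (t ∩ s) : ℂ) * c := by
  rw [setIntegralLpCLM_apply, setIntegral_indicatorConstLp hs ht hμt]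
  simp

/-- The normalized indicators of a sequence of disjoint sets have no weak cluster point in `L¹`:
a cluster point would have integral `0` over each set but integral `1` over their union. -/
theorem IsWeaklyCompactOperator.not_surjective_Lp_one {E : Type*} [NormedAddCommGroup E]
    [NormedSpace ℂ E] {T : E →ₗ[ℂ] Lp ℂ 1 μ} (hT : IsWeaklyCompactOperator T) {A : ℕ → Set X}
    (hA : ∀ n, MeasurableSet (A n)) (hd : Pairwise (Function.onFun Disjoint A))
    (h0 : ∀ n, μ (A n) ≠ 0) (htop : ∀ n, μ (A n) ≠ ∞) : ¬ Function.Surjective T := by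
  intro hs
  have hpos : ∀ n, 0 < μ.real (A n) := fun n => ENNReal.toReal_pos (h0 n) (htop n)
  obtain ⟨f, hf⟩ := hT.exists_hyperfilter_tendsto hs
    (u := fun n => indicatorConstLp 1 (hA n) (htop n) ((μ.real (A n) : ℂ)⁻¹)) fun n => by
      rw [norm_indicatorConstLp one_ne_zero ENNReal.one_ne_top]
      simp [abs_of_pos (hpos n), (hpos n).ne']
  have hzero : ∀ k, ∫ x in A k, f x ∂μ = 0 := fun k => by
    refine tendsto_nhds_unique (hf (setIntegralLpCLM μ (A k))) (tendsto_const_nhds.congr' ?_)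
    -- Nonprincipality gives `n > k` eventually, and then `A n` misses `A k`.
    filter_upwards [Nat.hyperfilter_le_atTop (eventually_gt_atTop k)] with n hn
    rw [setIntegralLpCLM_indicatorConstLp (hA k), (hd hn.ne').inter_eq]
    simp
  have hone : ∫ x in ⋃ k, A k, f x ∂μ = 1 := by
    refine tendsto_nhds_unique (hf (setIntegralLpCLM μ (⋃ k, A k)))
      (tendsto_const_nhds.congr fun n => ?_)
    rw [setIntegralLpCLM_indicatorConstLp (MeasurableSet.iUnion hA),
      Set.inter_eq_left.2 (Set.subset_iUnion A n), mul_inv_cancel₀]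
    exact_mod_cast (hpos n).ne'
  -- Countable additivity of the integral of `f` would make 1 a sum of zeros.
  rw [integral_iUnion hA hd (L1.integrable_coeFn f).integrableOn] at hone
  simp [hzero] at hone

end DisjointSets

theorem exists_seq_pairwise_disjoint_measure_ne_zero_ne_top {X : Type*} [TopologicalSpace X]
    [T2Space X] [Infinite X] [MeasurableSpace X] [OpensMeasurableSpace X] (μ : Measure X)
    [μ.IsOpenPosMeasure] [IsLocallyFiniteMeasure μ] :
    ∃ A : ℕ → Set X, (∀ n, MeasurableSet (A n)) ∧ Pairwise (Function.onFun Disjoint A) ∧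
      (∀ n, μ (A n) ≠ 0) ∧ ∀ n, μ (A n) ≠ ∞ := by
  obtain ⟨U, hinf, hopen, hd⟩ := exists_seq_infinite_isOpen_pairwise_disjoint X
  choose x hx using fun n => (hinf n).nonempty
  choose V hxV hVo hV using fun n => μ.exists_isOpen_measure_lt_top (x n)
  refine ⟨fun n => U n ∩ V n, fun n => ((hopen n).inter (hVo n)).measurableSet,
    fun i j hij => (hd hij).mono Set.inter_subset_left Set.inter_subset_left,
    fun n => ((hopen n).inter (hVo n)).measure_ne_zero μ ⟨x n, hx n, hxV n⟩,
    fun n => ((measure_mono Set.inter_subset_right).trans_lt (hV n)).ne⟩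

/-- `Lp` is a linear quotient of a subspace of the finite-dimensional space `X → ℂ`. -/
theorem finiteDimensional_Lp_of_finite {X : Type*} [Finite X] [MeasurableSpace X]
    (μ : Measure X) (p : ℝ≥0∞) [Fact (1 ≤ p)] : FiniteDimensional ℂ (Lp ℂ p μ) := by
  let V : Submodule ℂ (X → ℂ) :=
    { carrier := {f | MemLp f p μ}
      add_mem' := MemLp.add
      zero_mem' := MemLp.zero
      smul_mem' := fun c _ hf => hf.const_smul c }
  let L : V →ₗ[ℂ] Lp ℂ p μ :=
    { toFun := fun f => f.2.toLp f.1
      map_add' := fun _ _ => rfl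
      map_smul' := fun _ _ => rfl }
  exact Module.Finite.of_surjective L fun f => ⟨⟨f, Lp.memLp f⟩, Lp.toLp_coeFn f (Lp.memLp f)⟩

theorem theorem3p5 {G : Type*} [Group G] [TopologicalSpace G] [IsTopologicalGroup G]
    [LocallyCompactSpace G] [T2Space G] [MeasurableSpace G] [BorelSpace G]
    (μ : Measure G) [μ.IsHaarMeasure] [μ.Regular] :
    (∃ T : Lp ℂ 1 μ →ₗ[ℂ] Lp ℂ 1 μ,
      IsWeaklyCompactOperator T ∧ GroupAlgebraL1.IsEpimorphism T) ↔ Finite G := by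
  constructor
  · rintro ⟨T, hT, -, hs⟩
    by_contra hG
    have : Infinite G := not_finite_iff_infinite.1 hG
    obtain ⟨A, hA, hd, h0, htop⟩ := exists_seq_pairwise_disjoint_measure_ne_zero_ne_top μ
    exact hT.not_surjective_Lp_one hA hd h0 htop hs
  · intro hG
    have := finiteDimensional_Lp_of_finite μ 1
    exact ⟨LinearMap.id, isWeaklyCompactOperator_of_finiteDimensional _, fun _ _ => rfl,
      Function.surjective_id⟩
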